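/- All graphs are finite, undirected and simple. Given a graph $G$ and a set $\mathcal{X}$ of pairwise disjoint non-empty subsets of $V(G)$, let $G/\!\!/\mathcal{X}$ be the graph obtained from $G$ by identifying, for each $X\in\mathcal{X}$, the vertices of $X$ to a single vertex (discarding loops and multiple edges); its \emph{order} is $|\bigcup\mathcal{X}|$, the number of vertices taking part in the identifications. A graph $H$ is an \emph{identification minor} of $G$ if $H$ is isomorphic to $M/\!\!/\mathcal{X}$ for some minor $M$ of $G$ and some set $\mathcal{X}$ of pairwise disjoint non-empty subsets of $V(M)$. For $k\ge 1$, the \emph{$k$-marguerite} $k*K_3$ is the graph obtained from $k$ disjoint triangles by selecting one vertex of each and identifying the selected vertices to a single vertex. Theorem. There is a constant $C>0$ such that, for every integer $k\geq 1$ and every graph $G$, at least one of the following holds: $G$ contains $k*K_3$ as an identification minor; or there is a set $\mathcal{X}$ of pairwise disjoint non-empty subsets of $V(G)$ with $|\bigcup\mathcal{X}|\le C\,k^4\log^2 k$ such that $G/\!\!/\mathcal{X}$ is acyclic. -/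

import Mathlib

namespace IdMinor

universe u v

/-- `𝒳` is a partition of some set of vertices (namely of `⋃₀ 𝒳`): its members are non-empty and
pairwise disjoint. -/
def IsVertexPartition {V : Type u} (𝒳 : Set (Set V)) : Prop :=
  (∅ : Set V) ∉ 𝒳 ∧ 𝒳.PairwiseDisjoint id

/-- The order of a partition of a set of vertices: the size of the partitioned set. -/
noncomputable def order {V : Type u} (𝒳 : Set (Set V)) : ℕ := (⋃₀ 𝒳).ncard

/-- The vertices of the graph obtained by identifying each member of `𝒳`: the vertices outside
`⋃₀ 𝒳`, together with one new vertex (the heir) for each member of `𝒳`. -/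
abbrev IdVertex {V : Type u} (𝒳 : Set (Set V)) : Type u := ↥(⋃₀ 𝒳)ᶜ ⊕ ↥𝒳

/-- The set of original vertices that a vertex of the identified graph stands for. -/
def IdVertex.fiber {V : Type u} {𝒳 : Set (Set V)} : IdVertex 𝒳 → Set V
  | Sum.inl w => {w.1}
  | Sum.inr X => X.1

/-- The graph obtained from `G` by identifying each member of `𝒳` to a single vertex; loops and
multiple edges are suppressed. -/
def identify {V : Type u} (G : SimpleGraph V) (𝒳 : Set (Set V)) : SimpleGraph (IdVertex 𝒳) where
  Adj a b := a ≠ b ∧ ∃ x ∈ a.fiber, ∃ y ∈ b.fiber, G.Adj x y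
  symm := ⟨fun _ _ ⟨hne, x, hx, y, hy, h⟩ => ⟨hne.symm, y, hy, x, hx, h.symm⟩⟩
  loopless := ⟨fun _ h => h.1 rfl⟩

/-- `H` is a minor of `G`: there is a model of `H` in `G`, that is, a family of pairwise disjoint
(non-empty) connected vertex sets of `G`, one for each vertex of `H`, such that the sets of
adjacent vertices of `H` are joined by an edge of `G`. -/
def IsMinor {W : Type v} {V : Type u} (H : SimpleGraph W) (G : SimpleGraph V) : Prop :=
  ∃ S : W → Set V,
    (∀ w, (G.induce (S w)).Connected) ∧
    (∀ w w', w ≠ w' → Disjoint (S w) (S w')) ∧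
    (∀ w w', H.Adj w w' → ∃ x ∈ S w, ∃ y ∈ S w', G.Adj x y)

/-- `H` is an identification minor of `G`: up to isomorphism, `H` is obtained from a minor of `G`
by identifying vertices. -/
def IsIdentificationMinor {U : Type v} {V : Type u} (H : SimpleGraph U) (G : SimpleGraph V) :
    Prop :=
  ∃ (W : Type u) (M : SimpleGraph W) (𝒳 : Set (Set W)),
    IsMinor M G ∧ IsVertexPartition 𝒳 ∧ Nonempty (identify M 𝒳 ≃g H)

/-- The disjoint union of `k` triangles. -/
def disjointTriangles (k : ℕ) : SimpleGraph (Fin k × Fin 3) where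
  Adj a b := a.1 = b.1 ∧ a.2 ≠ b.2
  symm := ⟨fun _ _ h => ⟨h.1.symm, h.2.symm⟩⟩
  loopless := ⟨fun _ h => h.2 rfl⟩

/-- The `k`-marguerite: select one vertex from each of `k` disjoint triangles, and identify the
selected vertices to a single one. -/
def marguerite (k : ℕ) :
    SimpleGraph (IdVertex ({{a : Fin k × Fin 3 | a.2 = 0}} : Set (Set (Fin k × Fin 3)))) :=
  identify (disjointTriangles k) {{a | a.2 = 0}}

end IdMinor

/-!
Contractions are special identifications, so `H` is an identification minor of `G` as soon as some
map from the vertices of `G` onto those of `H` sends, for each edge of `H`, some edge of `G` to it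
(`isIdentificationMinor_of_map`): delete the edges not sent to edges of `H`, then identify the
fibers. No connectivity is required of the fibers.

In particular three disjoint edges map onto a triangle, so `3k` disjoint edges give the
`k`-marguerite. If `G` has no `3k` disjoint edges, then the ends of a maximal family of disjoint
edges form a vertex cover with at most `6k` vertices (`exists_disjoint_edges_or_vertexCover`), and
identifying a vertex cover to a single vertex leaves a star, which is acyclic. For `k ≥ 2` this
linear bound is below `4 k⁴ log² k`.

For `k = 1` the bound is zero, so nothing may be identified: either `G` is acyclic, or a cycle of
`G` maps onto the triangle.
-/

namespace IdMinor

open SimpleGraph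

/-! ### Identification minors from maps covering all edges -/

/-- Only edge-surjectivity of `f` matters: edges of `G` that `f` sends to non-edges of `H` are
deleted before the fibers of `f` are identified. -/
theorem isIdentificationMinor_of_map {U : Type v} {V : Type u} {H : SimpleGraph U}
    {G : SimpleGraph V} (f : V → U) (hf : Function.Surjective f)
    (hadj : ∀ a b, H.Adj a b → ∃ x y, G.Adj x y ∧ f x = a ∧ f y = b) :
    IsIdentificationMinor H G := by
  let 𝒳 : Set (Set V) := Set.range fun a => f ⁻¹' {a}
  let g : U → IdVertex 𝒳 := fun a => Sum.inr ⟨f ⁻¹' {a}, a, rfl⟩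
  have hg : Function.Bijective g := by
    constructor
    · intro a b hab
      obtain ⟨x, rfl⟩ := hf a
      have h : f ⁻¹' {f x} = f ⁻¹' {b} := congrArg Subtype.val (Sum.inr_injective hab)
      have hx : x ∈ f ⁻¹' {b} := h ▸ (rfl : f x = f x)
      exact hx
    · rintro (⟨x, hx⟩ | ⟨_, a, rfl⟩)
      · exact (hx ⟨f ⁻¹' {f x}, ⟨f x, rfl⟩, rfl⟩).elim
      · exact ⟨a, rfl⟩
  refine ⟨V, G ⊓ H.comap f, 𝒳, ⟨fun x => {x}, fun x => ?_, fun x y h => ?_, fun x y h => ?_⟩,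
    ⟨?_, ?_⟩, ⟨RelIso.symm ⟨Equiv.ofBijective g hg, ?_⟩⟩⟩
  · exact Connected.of_subsingleton
  · simpa using h
  · exact ⟨x, rfl, y, rfl, h.1⟩
  · rintro ⟨a, ha⟩
    obtain ⟨x, rfl⟩ := hf a
    exact Set.notMem_empty x (ha ▸ (rfl : f x = f x))
  · rintro _ ⟨a, rfl⟩ _ ⟨b, rfl⟩ hab
    refine Set.disjoint_left.2 fun x hx hy => hab ?_
    have hx : f x = a := hx
    have hy : f x = b := hy
    subst hx hy
    rfl
  · intro a b
    constructor
    · rintro ⟨-, x, hx, y, hy, -, h⟩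
      have hx : f x = a := hx
      have hy : f y = b := hy
      subst hx hy
      exact h
    · intro h
      obtain ⟨x, y, hxy, rfl, rfl⟩ := hadj a b h
      exact ⟨fun e => h.ne (hg.1 e), x, rfl, y, rfl, hxy, h⟩

theorem exists_fiber_map {V : Type u} (𝒳 : Set (Set V)) (h𝒳 : IsVertexPartition 𝒳) :
    ∃ q : V → IdVertex 𝒳, ∀ w, ∀ x ∈ w.fiber, q x = w := by
  have key : ∀ x, ∃ w : IdVertex 𝒳, x ∈ w.fiber := by
    intro x
    by_cases hx : x ∈ ⋃₀ 𝒳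
    · obtain ⟨X, hX, hxX⟩ := hx
      exact ⟨Sum.inr ⟨X, hX⟩, hxX⟩
    · exact ⟨Sum.inl ⟨x, hx⟩, rfl⟩
  choose q hq using key
  refine ⟨q, fun w x hx => ?_⟩
  have h := hq x
  generalize q x = w' at h
  rcases w with ⟨y, hy⟩ | ⟨X, hX⟩ <;> rcases w' with ⟨y', hy'⟩ | ⟨X', hX'⟩
  · have hx : x = y := hx
    have h : x = y' := h
    subst hx h
    rfl
  · have hx : x = y := hx
    subst hx
    exact (hy ⟨X', hX', h⟩).elim
  · have h : x = y' := h
    subst h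
    exact (hy' ⟨X, hX, hx⟩).elim
  · have : X' = X := h𝒳.2.elim_set hX' hX x h hx
    subst this
    rfl

theorem IdVertex.fiber_nonempty {V : Type u} {𝒳 : Set (Set V)} (h𝒳 : IsVertexPartition 𝒳)
    (w : IdVertex 𝒳) : w.fiber.Nonempty := by
  rcases w with ⟨y, hy⟩ | ⟨X, hX⟩
  · exact Set.singleton_nonempty y
  · exact Set.nonempty_iff_ne_empty.2 fun h => h𝒳.1 (h ▸ hX)

/-- It is enough to cover the edges of `k` disjoint triangles, one cyclic orientation of each. -/
theorem isIdentificationMinor_marguerite {V : Type u} {G : SimpleGraph V} {k : ℕ} (hk : 1 ≤ k)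
    (f : V → Fin k × Fin 3)
    (hf : ∀ i p, ∃ x y, G.Adj x y ∧ f x = (i, p) ∧ f y = (i, p + 1)) :
    IsIdentificationMinor (marguerite k) G := by
  have h𝒳 : IsVertexPartition ({{a | a.2 = 0}} : Set (Set (Fin k × Fin 3))) := by
    refine ⟨fun h => ?_, Set.pairwiseDisjoint_singleton _ _⟩
    exact Set.notMem_empty ((⟨0, hk⟩, 0) : Fin k × Fin 3)
      (Set.mem_singleton_iff.1 h ▸ (rfl : (0 : Fin 3) = 0))
  obtain ⟨q, hq⟩ := exists_fiber_map _ h𝒳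
  refine isIdentificationMinor_of_map (q ∘ f) ?_ ?_
  · intro w
    obtain ⟨⟨i, p⟩, ha⟩ := IdVertex.fiber_nonempty h𝒳 w
    obtain ⟨x, -, -, hx, -⟩ := hf i p
    exact ⟨x, by rw [Function.comp_apply, hx, hq w _ ha]⟩
  · rintro w w' ⟨-, ⟨i, p⟩, ha, ⟨j, r⟩, hb, hij, hpr⟩
    obtain rfl : i = j := hij
    have h3 : ∀ p r : Fin 3, p ≠ r → r = p + 1 ∨ p = r + 1 := by decide
    rcases h3 p r hpr with h | h
    · obtain ⟨x, y, hxy, hx, hy⟩ := hf i p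
      rw [← h] at hy
      exact ⟨x, y, hxy, by rw [Function.comp_apply, hx, hq w _ ha],
        by rw [Function.comp_apply, hy, hq w' _ hb]⟩
    · obtain ⟨x, y, hxy, hx, hy⟩ := hf i r
      rw [← h] at hy
      exact ⟨y, x, hxy.symm, by rw [Function.comp_apply, hy, hq w _ ha],
        by rw [Function.comp_apply, hx, hq w' _ hb]⟩

/-- The edges `x a y a` are pairwise disjoint; the edge with index `(i, p)` is sent to the edge
joining `p` and `p + 1` in the `i`-th triangle. -/
theorem isIdentificationMinor_marguerite_of_disjoint_edges {V : Type u} {G : SimpleGraph V}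
    {k : ℕ} (hk : 1 ≤ k) {x y : Fin k × Fin 3 → V} (hx : Function.Injective x)
    (hy : Function.Injective y) (hxy : ∀ a b, x a ≠ y b) (hadj : ∀ a, G.Adj (x a) (y a)) :
    IsIdentificationMinor (marguerite k) G := by
  refine isIdentificationMinor_marguerite hk
    (Function.extend x id (Function.extend y (fun a => (a.1, a.2 + 1)) fun _ => (⟨0, hk⟩, 0)))
    fun i p => ⟨x (i, p), y (i, p), hadj _, hx.extend_apply _ _ _, ?_⟩
  rw [Function.extend_apply' _ _ _ fun ⟨a, ha⟩ => hxy _ _ ha, hy.extend_apply]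

/-- A cycle `u, v, w, …` maps onto a triangle: keep `u` and `v`, and identify all the others. -/
theorem isIdentificationMinor_marguerite_one {V : Type u} {G : SimpleGraph V}
    (hG : ¬ G.IsAcyclic) : IsIdentificationMinor (marguerite 1) G := by
  classical
  simp only [IsAcyclic, not_forall, not_not] at hG
  obtain ⟨u, c, hc⟩ := hG
  match c, hc with
  | .nil, hc => exact (hc.not_nil Walk.nil_nil).elim
  | .cons (v := v) huv .nil, hc => exact (huv.ne rfl).elim
  | .cons (v := v) huv (.cons (v := w) hvw r), hc =>
    have hpath := (Walk.cons_isCycle_iff _ _).1 hc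
    have hr := (Walk.cons_isPath_iff _ _).1 hpath.1
    have hwu : w ≠ u := by
      rintro rfl
      exact hpath.2 (by simp [Sym2.eq_swap])
    have hpen : G.Adj r.penultimate u := r.adj_penultimate (Walk.not_nil_of_ne hwu)
    have hpv : r.penultimate ≠ v := fun h => hr.2 (h ▸ r.getVert_mem_support _)
    refine isIdentificationMinor_marguerite le_rfl
      (fun z => (0, if z = u then 0 else if z = v then 1 else 2)) fun i p => ?_
    obtain rfl : i = 0 := Subsingleton.elim _ _
    fin_cases p
    · exact ⟨u, v, huv, by simp, by simp [huv.ne']⟩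
    · exact ⟨v, w, hvw, by simp [huv.ne'], by simp [hwu, hvw.ne']⟩
    · exact ⟨r.penultimate, u, hpen, by simp [hpen.ne, hpv], by simp⟩

/-! ### Vertex covers -/

theorem exists_disjoint_edges_or_vertexCover {V : Type u} (G : SimpleGraph V) (n : ℕ) :
    (∃ x y : Fin n → V, Function.Injective x ∧ Function.Injective y ∧ (∀ a b, x a ≠ y b) ∧
      ∀ a, G.Adj (x a) (y a)) ∨
    ∃ S : Finset V, S.card ≤ 2 * n ∧ G.IsVertexCover S := by
  classical
  induction n with
  | zero => exact Or.inl ⟨Fin.elim0, Fin.elim0, fun a => a.elim0, fun a => a.elim0,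
      fun a => a.elim0, fun a => a.elim0⟩
  | succ n ih =>
    rcases ih with ⟨x, y, hx, hy, hxy, hadj⟩ | ⟨S, hS, hcov⟩
    · by_cases hcov : G.IsVertexCover ↑(Finset.univ.image x ∪ Finset.univ.image y)
      · refine Or.inr ⟨_, ?_, hcov⟩
        have h1 := Finset.card_union_le (Finset.univ.image x) (Finset.univ.image y)
        have h2 : (Finset.univ.image x).card ≤ n := by
          simpa using Finset.card_image_le (s := Finset.univ) (f := x)
        have h3 : (Finset.univ.image y).card ≤ n := by
          simpa using Finset.card_image_le (s := Finset.univ) (f := y)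
        omega
      · simp only [IsVertexCover, not_forall, not_or, Finset.mem_coe] at hcov
        obtain ⟨u, v, huv, hu, hv⟩ := hcov
        simp only [Finset.mem_union, Finset.mem_image, Finset.mem_univ, true_and, not_or,
          not_exists] at hu hv
        refine Or.inl ⟨Fin.cons u x, Fin.cons v y, Fin.cons_injective_iff.2 ⟨?_, hx⟩,
          Fin.cons_injective_iff.2 ⟨?_, hy⟩, ?_, ?_⟩
        · rintro ⟨a, ha⟩
          exact hu.1 a ha
        · rintro ⟨a, ha⟩
          exact hv.2 a ha
        · intro a b
          refine Fin.cases ?_ (fun a => ?_) a <;> refine Fin.cases ?_ (fun b => ?_) b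
          · simpa using huv.ne
          · simpa using fun h => hu.2 b h.symm
          · simpa using hv.1 a
          · simpa using hxy a b
        · intro a
          refine Fin.cases ?_ (fun a => ?_) a
          · simpa using huv
          · simpa using hadj a
    · exact Or.inr ⟨S, by omega, hcov⟩

theorem isAcyclic_of_forall_adj_eq {V : Type u} {G : SimpleGraph V} (c : V)
    (hc : ∀ u v, G.Adj u v → u = c ∨ v = c) : G.IsAcyclic := by
  intro u p hp
  match p, hp with
  | .nil, hp => exact hp.not_nil Walk.nil_nil
  | .cons h .nil, _ => exact h.ne rfl
  | .cons _ (.cons _ .nil), hp =>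
    exact absurd hp.three_le_length (by simp)
  | .cons (v := v) huv (.cons (v := w) hvw (.cons (v := x) hwx r)), hp =>
    have hnd := hp.support_nodup
    simp only [Walk.support_cons, List.tail_cons, List.nodup_cons, List.mem_cons, not_or] at hnd
    have hvx : v ≠ x := fun h => hnd.1.2 (h ▸ r.start_mem_support)
    have hwu : w ≠ u := fun h => hnd.2.1 (h ▸ r.end_mem_support)
    rcases hc v w hvw with h | h
    · rcases hc w x hwx with h' | h'
      · exact hvw.ne (h.trans h'.symm)
      · exact hvx (h.trans h'.symm)
    · rcases hc u v huv with h' | h'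
      · exact hwu (h.trans h'.symm)
      · exact hvw.ne (h'.trans h.symm)

theorem isAcyclic_identify_vertexCover {V : Type u} {G : SimpleGraph V} {S : Set V}
    (hS : G.IsVertexCover S) : (identify G {S}).IsAcyclic := by
  refine isAcyclic_of_forall_adj_eq (Sum.inr ⟨S, rfl⟩) ?_
  have key : ∀ (w : IdVertex {S}) x, x ∈ w.fiber → x ∈ S → w = Sum.inr ⟨S, rfl⟩ := by
    rintro (⟨y, hy⟩ | ⟨X, hX⟩) x hx hxS
    · have hx : x = y := hx
      subst hx
      exact (hy ⟨S, rfl, hxS⟩).elim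
    · obtain rfl : X = S := hX
      rfl
  rintro w w' ⟨-, x, hx, y, hy, h⟩
  exact (hS h).imp (key w x hx) (key w' y hy)

theorem isAcyclic_identify_empty {V : Type u} {G : SimpleGraph V} (hG : G.IsAcyclic) :
    (identify G ∅).IsAcyclic := by
  let g : IdVertex (∅ : Set (Set V)) → V := Sum.elim Subtype.val fun X => X.2.elim
  have hg : Function.Injective g := by
    rintro (a | a) (b | b) h
    · exact congrArg Sum.inl (Subtype.ext h)
    · exact b.2.elim
    · exact a.2.elim
    · exact a.2.elim
  refine hG.comap ⟨g, ?_⟩ hg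
  rintro (a | a) (b | b) ⟨-, x, hx, y, hy, h⟩
  · have hx : x = a := hx
    have hy : y = b := hy
    subst hx hy
    exact h
  · exact b.2.elim
  · exact a.2.elim
  · exact a.2.elim

end IdMinor

theorem mainTheorem10 :
    ∃ C : ℝ, 0 < C ∧ ∀ k : ℕ, 1 ≤ k → ∀ (V : Type*) [Finite V] (G : SimpleGraph V),
      IdMinor.IsIdentificationMinor (IdMinor.marguerite k) G ∨
      ∃ 𝒳 : Set (Set V), IdMinor.IsVertexPartition 𝒳 ∧
        (IdMinor.identify G 𝒳).IsAcyclic ∧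
        (IdMinor.order 𝒳 : ℝ) ≤ C * ((k : ℝ) ^ 4 * Real.log (k : ℝ) ^ 2) := by
  refine ⟨4, by norm_num, fun k hk V _ G => ?_⟩
  by_cases hG : G.IsAcyclic
  · refine Or.inr ⟨∅, ⟨Set.notMem_empty _, Set.pairwiseDisjoint_empty⟩,
      IdMinor.isAcyclic_identify_empty hG, ?_⟩
    rw [IdMinor.order, Set.sUnion_empty, Set.ncard_empty, Nat.cast_zero]
    positivity
  rcases hk.eq_or_lt with rfl | hk2
  · exact Or.inl (IdMinor.isIdentificationMinor_marguerite_one hG)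
  rcases IdMinor.exists_disjoint_edges_or_vertexCover G (k * 3) with
    ⟨x, y, hx, hy, hxy, hadj⟩ | ⟨S, hS, hcov⟩
  · exact Or.inl (IdMinor.isIdentificationMinor_marguerite_of_disjoint_edges hk
      (hx.comp finProdFinEquiv.injective) (hy.comp finProdFinEquiv.injective)
      (fun a b => hxy _ _) fun a => hadj _)
  · refine Or.inr ⟨{(S : Set V)}, ⟨fun h => hG ?_, Set.pairwiseDisjoint_singleton _ _⟩,
      IdMinor.isAcyclic_identify_vertexCover hcov, ?_⟩
    · -- An empty vertex cover means that there are no edges at all.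
      have hbot : G = ⊥ :=
        SimpleGraph.isVertexCover_empty.1 ((Set.mem_singleton_iff.1 h).symm ▸ hcov)
      rw [hbot]
      exact SimpleGraph.isAcyclic_bot
    · rw [IdMinor.order, Set.sUnion_singleton, Set.ncard_coe_finset]
      have hk' : (2 : ℝ) ≤ k := by exact_mod_cast hk2
      have hS' : (S.card : ℝ) ≤ 6 * k := by
        have : S.card ≤ 6 * k := by omega
        exact_mod_cast this
      have hlog : (1 / 2 : ℝ) ≤ Real.log k :=
        (by linarith [Real.log_two_gt_d9] : (1 / 2 : ℝ) ≤ Real.log 2).trans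
          (Real.log_le_log (by norm_num) hk')
      have h3 : (2 : ℝ) ^ 3 ≤ (k : ℝ) ^ 3 := by gcongr
      have h2 : (1 / 2 : ℝ) ^ 2 ≤ Real.log k ^ 2 := by gcongr
      calc (S.card : ℝ) ≤ 6 * k := hS'
        _ ≤ 4 * ((k * 2 ^ 3) * (1 / 2) ^ 2) := by linarith
        _ ≤ 4 * ((k * (k : ℝ) ^ 3) * Real.log k ^ 2) := by gcongr
        _ = 4 * ((k : ℝ) ^ 4 * Real.log k ^ 2) := by ring
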